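/- Let $m\ge 1$, $V=\mathbb Z^m$, let $E$ be a measurable space (for instance $E=\mathbb N$, $\{0,\dots,N\}$ or $\mathbb R_+$), and let $\hat E\subseteq\mathbb N$ with $0,1\in\hat E$. Put $\Omega=E^V$ with the product $\sigma$-algebra, and let $\hat\Omega$ be the countable set of finite configurations $\xi\in\hat E^V$, i.e. those with $|\xi|:=\sum_{x\in V}\xi_x<\infty$; $\delta_x\in\hat\Omega$ is the configuration with one particle at $x$ and none elsewhere. Let $\{\eta(t),t\ge0\}$ be a Markov process on $\Omega$ and $\{\xi(t),t\ge 0\}$ a Markov process on $\hat\Omega$ which conserves the number of particles ($|\xi(t)|=|\xi(0)|$ almost surely). Assume the following. - *Factorized duality.* There are measurable functions $d(k,\cdot):E\to\mathbb R$, $k\in\hat E$, with $d(0,\cdot)\equiv1$, such that $D(\xi,\eta)=\prod_{x\in V}d(\xi_x,\eta_x)$ satisfies $\hat{\mathbb E}_\xi D(\xi(t),\eta)=\mathbb E_\eta D(\xi,\eta(t))$ for all $t>0$, $\xi\in\hat\Omega$, $\eta\in\Omega$. - *Bounded harmonic triviality.* Every bounded $H:\hat\Omega\to\mathbb R$ with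 $\hat{\mathbb E}_\xi H(\xi(t))=H(\xi)$ for all $t>0$ and $\xi\in\hat\Omega$ is of the form $H(\xi)=\psi(|\xi|)$ for some bounded $\psi:\mathbb N\to\mathbb R$. Let $\mu$ be a probability measure on $\Omega$ that is stationary for $\{\eta(t),t\ge0\}$, invariant under all translations of $\mathbb Z^m$ and ergodic under translations (every translation-invariant measurable set has $\mu$-measure $0$ or $1$). Assume *uniform domination*: for every $n\in\mathbb N$ there is a $\mu$-integrable function $f_n$ such that, for every $\xi\in\hat\Omega$ with $|\xi|=n$, $|D(\xi,\eta)|\le f_n(\eta)$ for $\mu$-almost every $\eta\in\Omega$. Then for all $\xi\in\hat\Omega$ and all $x\in V$, $$\int D(\xi,\eta)\,\mu(d\eta)=\Big(\int D(\delta_x,\eta)\,\mu(d\eta)\Big)^{|\xi|}.$$ If, moreover, $d$ is measure determining (any two probability measures $\nu_1,\nu_2$ on $E$ for which all $d(k,\cdot)$, $k\in\hat E$, are integrable with $\int d(k,\cdot)\,d\nu_1=\int d(k,\cdot)\,d\nu_2$ coincide), then $\mu$ is a product measure: $\mu=\bigotimes_{x\in V}\nu$ for some probability measure $\nu$ on $E$.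 -/

import Mathlib

open MeasureTheory ProbabilityTheory
open scoped NNReal ENNReal

noncomputable section

namespace FactorizedDuality

/-- The lattice `ℤ^dim`. -/
abbrev Site (dim : ℕ) : Type := Fin dim → ℤ

/-- Configurations `η ∈ E^V`, `V = ℤ^dim`, with the product σ-algebra. -/
abbrev Config (dim : ℕ) (E : Type*) : Type _ := Site dim → E

/-- Finite dual configurations: `ξ ∈ Ê^V` with finitely many particles. -/
def FinConfig (dim : ℕ) (Ehat : Set ℕ) : Type :=
  {ξ : Site dim →₀ ℕ // ∀ x, ξ x ∈ Ehat}

/-- The dual state space is countable and carries the discrete σ-algebra. -/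
instance (dim : ℕ) (Ehat : Set ℕ) : MeasurableSpace (FinConfig dim Ehat) := ⊤

/-- The number of particles `|ξ| = ∑ₓ ξₓ`. -/
def FinConfig.size {dim : ℕ} {Ehat : Set ℕ} (ξ : FinConfig dim Ehat) : ℕ :=
  ξ.1.sum fun _ k => k

/-- A time-homogeneous Markov process on `S`, given by its transition function:
`trans t x` is the law at time `t` of the process started at `x`. -/
structure MarkovProcess (S : Type*) [MeasurableSpace S] where
  trans : ℝ≥0 → Kernel S S
  isMarkovKernel : ∀ t, IsMarkovKernel (trans t)
  trans_zero : trans 0 = Kernel.id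
  trans_add : ∀ s t, trans (s + t) = trans t ∘ₖ trans s

/-- `𝔼ₓ[f(X(t))]`. -/
def MarkovProcess.expect {S : Type*} [MeasurableSpace S] (X : MarkovProcess S)
    (t : ℝ≥0) (x : S) (f : S → ℝ) : ℝ :=
  ∫ y, f y ∂(X.trans t x)

/-- `μ` is a stationary measure: if `X(0)` has law `μ`, then so does `X(t)`, for all `t ≥ 0`. -/
def MarkovProcess.IsStationary {S : Type*} [MeasurableSpace S] (X : MarkovProcess S)
    (μ : Measure S) : Prop :=
  ∀ t, (X.trans t).Invariant μ

/-- The factorized duality function `D(ξ, η) = ∏ₓ d(ξₓ, ηₓ)`. The product runs over the sites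
with `ξₓ ≠ 0`; the other factors are `1` because `d(0, ·) ≡ 1` is assumed wherever it is used. -/
def dualityFun {dim : ℕ} {E : Type*} (d : ℕ → E → ℝ) (ξ : Site dim →₀ ℕ)
    (η : Config dim E) : ℝ :=
  ξ.prod fun x k => d k (η x)

/-- The duality relation `𝔼_ξ D(ξ(t), η) = 𝔼_η D(ξ, η(t))` for all `t > 0`, `ξ`, `η`.
Existence of the expectations is not demanded separately. -/
def IsDual {dim : ℕ} {E : Type*} [MeasurableSpace E] {Ehat : Set ℕ}
    (X : MarkovProcess (FinConfig dim Ehat)) (Y : MarkovProcess (Config dim E))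
    (d : ℕ → E → ℝ) : Prop :=
  ∀ t : ℝ≥0, 0 < t → ∀ (ξ : FinConfig dim Ehat) (η : Config dim E),
    X.expect t ξ (fun ξ' => dualityFun d ξ'.1 η) = Y.expect t η (fun η' => dualityFun d ξ.1 η')

/-- The dynamics conserves the number of particles almost surely. -/
def ConservesParticles {dim : ℕ} {Ehat : Set ℕ}
    (X : MarkovProcess (FinConfig dim Ehat)) : Prop :=
  ∀ (t : ℝ≥0) (ξ : FinConfig dim Ehat), ∀ᵐ ξ' ∂(X.trans t ξ), ξ'.size = ξ.size

/-- `H` is harmonic: `𝔼_ξ H(ξ(t)) = H(ξ)` for all `t > 0` and all `ξ`. -/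
def IsHarmonic {dim : ℕ} {Ehat : Set ℕ} (X : MarkovProcess (FinConfig dim Ehat))
    (H : FinConfig dim Ehat → ℝ) : Prop :=
  ∀ t : ℝ≥0, 0 < t → ∀ ξ, X.expect t ξ H = H ξ

/-- Bounded harmonic triviality: every bounded harmonic function is a bounded function of the
number of particles. -/
def BoundedHarmonicTriviality {dim : ℕ} {Ehat : Set ℕ}
    (X : MarkovProcess (FinConfig dim Ehat)) : Prop :=
  ∀ H : FinConfig dim Ehat → ℝ, (∃ C, ∀ ξ, |H ξ| ≤ C) → IsHarmonic X H →
    ∃ ψ : ℕ → ℝ, (∃ C, ∀ n, |ψ n| ≤ C) ∧ ∀ ξ, H ξ = ψ ξ.size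

/-- Uniform domination: for every `n` there is a `μ`-integrable `f` with
`|D(ξ, η)| ≤ f(η)` whenever `|ξ| = n`. The bound is only asked for `μ`-almost every `η`; as there
are countably many `ξ`, the exceptional null set may be taken independent of `ξ`. -/
def UniformDomination {dim : ℕ} {E : Type*} [MeasurableSpace E] (Ehat : Set ℕ)
    (d : ℕ → E → ℝ) (μ : Measure (Config dim E)) : Prop :=
  ∀ n : ℕ, ∃ f : Config dim E → ℝ, Integrable f μ ∧
    ∀ ξ : FinConfig dim Ehat, ξ.size = n → ∀ᵐ η ∂μ, |dualityFun d ξ.1 η| ≤ f η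

/-- The single-site functions `d(k, ·)`, `k ∈ Ê`, are measure determining on `E`. -/
def MeasureDetermining {E : Type*} [MeasurableSpace E] (Ehat : Set ℕ) (d : ℕ → E → ℝ) : Prop :=
  ∀ ν₁ ν₂ : Measure E, IsProbabilityMeasure ν₁ → IsProbabilityMeasure ν₂ →
    (∀ k ∈ Ehat, Integrable (d k) ν₁ ∧ Integrable (d k) ν₂ ∧
      ∫ e, d k e ∂ν₁ = ∫ e, d k e ∂ν₂) →
    ν₁ = ν₂

/-- The translation `(τ_z η)ₓ = η_{x+z}`. -/
def shiftConfig {dim : ℕ} {E : Type*} (z : Site dim) (η : Config dim E) : Config dim E :=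
  fun x => η (x + z)

def TranslationInvariant {dim : ℕ} {E : Type*} [MeasurableSpace E]
    (μ : Measure (Config dim E)) : Prop :=
  ∀ z : Site dim, μ.map (shiftConfig z) = μ

/-- Ergodicity under translations: every measurable set which is invariant under all translations
has measure `0` or `1`. -/
def TranslationErgodic {dim : ℕ} {E : Type*} [MeasurableSpace E]
    (μ : Measure (Config dim E)) : Prop :=
  ∀ A : Set (Config dim E), MeasurableSet A → (∀ z : Site dim, shiftConfig z ⁻¹' A = A) →
    μ A = 0 ∨ μ A = 1

end FactorizedDuality

end

open FactorizedDuality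

/-! Averaging the duality relation against the stationary `μ` shows that ξ ↦ ∫ D(ξ, ·) dμ is
harmonic for the dual process. Each level |ξ| = n is preserved by the dynamics, and there this
function is bounded by ∫ f_n, so bounded harmonic triviality makes it equal to ψ(|ξ|)
(`exists_integral_dualityFun_eq_of_size`).

Spatial ergodicity then makes ψ multiplicative. A particle added to ξ at any empty site y gives ∫
D(ξ, η) d(1, η_y) dμ = ψ(|ξ| + 1), independently of y. Averages of d(1, η_y) over suitable sites y
tend to ψ(1), so ψ(n + 1) = ψ(n) ψ(1) (`integral_dualityFun_succ`). Since D(ξ, ·) times such an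
average is a convex combination of duality functions with |ξ| + 1 particles, f_{|ξ|+1} dominates it.

For the product structure, let ν be the law of η_0; its d(k, ·)-moments are ψ(1)^k. Determinacy,
applied to signed weights (`MeasureDetermining.integral_mul_indicator`), turns the factors d(k, η_y)
into indicators one site at a time, which yields the cylinder probabilities. -/

/-! ### Fixed vectors in convex hulls of orbits -/

section Orbits

/-- A group acting by linear isometries has a fixed vector in the closed convex hull of
each orbit, namely the element of minimal norm. -/
theorem exists_fixed_mem_closure_convexHull_orbit {H G : Type*} [NormedAddCommGroup H]
    [InnerProductSpace ℝ H] [CompleteSpace H] [AddGroup G] (U : G → H →ₗᵢ[ℝ] H)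
    (hU : ∀ a b f, U a (U b f) = U (b + a) f) (f : H) :
    ∃ u ∈ closure (convexHull ℝ (Set.range fun a => U a f)), ∀ a, U a u = u := by
  set C := convexHull ℝ (Set.range fun a => U a f) with hC
  have hconv : Convex ℝ (closure C) := (convex_convexHull ℝ _).closure
  have hne : (closure C).Nonempty :=
    ⟨U 0 f, subset_closure (subset_convexHull ℝ _ ⟨0, rfl⟩)⟩
  obtain ⟨u, hu, hmin⟩ := exists_norm_eq_iInf_of_complete_convex hne
    isClosed_closure.isComplete hconv 0
  rw [norm_eq_iInf_iff_real_inner_le_zero hconv hu] at hmin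
  refine ⟨u, hu, fun a => ?_⟩
  have hmaps : Set.MapsTo (U a) C C := by
    have : U a '' C ⊆ C := by
      rw [hC, ← LinearIsometry.coe_toLinearMap, LinearMap.image_convexHull]
      refine convexHull_mono ?_
      rintro _ ⟨_, ⟨b, rfl⟩, rfl⟩
      exact ⟨b + a, (hU a b f).symm⟩
    exact Set.mapsTo_iff_image_subset.2 this
  have hmem : U a u ∈ closure C := hmaps.closure (U a).continuous hu
  -- Minimality of the norm at `u` gives ‖u‖² ≤ ⟪u, U a u⟫; since ‖U a u‖ = ‖u‖, expanding ‖U a u -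
  -- u‖² leaves a nonpositive number.
  have h1 := hmin _ hmem
  rw [zero_sub, inner_neg_left, inner_sub_right, real_inner_self_eq_norm_sq] at h1
  have h2 := norm_sub_sq_real (U a u) u
  rw [(U a).norm_map, real_inner_comm] at h2
  have h3 : ‖U a u - u‖ ^ 2 ≤ 0 := by linarith
  have h4 : ‖U a u - u‖ = 0 := by
    have := sq_nonneg ‖U a u - u‖
    exact pow_eq_zero_iff (two_ne_zero) |>.1 (le_antisymm h3 this)
  exact sub_eq_zero.1 (norm_eq_zero.1 h4)

end Orbits

/-! ### Translations and the mean ergodic theorem -/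

section Shift

theorem shiftConfig_shiftConfig {dim : ℕ} {E : Type*} (a b : Site dim) (η : Config dim E) :
    shiftConfig a (shiftConfig b η) = shiftConfig (a + b) η := by
  funext x; simp [shiftConfig, add_assoc]

variable {dim : ℕ} {E : Type*} [MeasurableSpace E] {μ : Measure (Config dim E)}

theorem measurable_shiftConfig (z : Site dim) :
    Measurable (shiftConfig z : Config dim E → Config dim E) :=
  measurable_pi_lambda _ fun x => measurable_pi_apply (x + z)

theorem measurableEmbedding_shiftConfig (z : Site dim) :
    MeasurableEmbedding (shiftConfig z : Config dim E → Config dim E) := by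
  refine MeasurableEmbedding.of_measurable_inverse (g := shiftConfig (-z))
    (measurable_shiftConfig z) ?_ (measurable_shiftConfig _) fun η => ?_
  · have : Set.range (shiftConfig z : Config dim E → Config dim E) = Set.univ :=
      Set.range_eq_univ.2 fun η => ⟨shiftConfig (-z) η, by
        rw [shiftConfig_shiftConfig]; funext x; simp [shiftConfig]⟩
    rw [this]; exact MeasurableSet.univ
  · rw [shiftConfig_shiftConfig]; funext x; simp [shiftConfig]

theorem FactorizedDuality.TranslationInvariant.measurePreserving (h : TranslationInvariant μ)
    (z : Site dim) : MeasurePreserving (shiftConfig z) μ μ :=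
  ⟨measurable_shiftConfig z, h z⟩

/-- The intersection of all translates of `A` is strictly invariant, and it differs from `A` by a
null set because the lattice is countable. -/
theorem measure_eq_zero_or_one_of_ae_invariant
    (herg : TranslationErgodic μ) {A : Set (Config dim E)} (hA : MeasurableSet A)
    (hAinv : ∀ z, shiftConfig z ⁻¹' A =ᵐ[μ] A) : μ A = 0 ∨ μ A = 1 := by
  have hB : (⋂ z, shiftConfig z ⁻¹' A) =ᵐ[μ] A := by
    have := Filter.EventuallyEq.countable_iInter hAinv
    rwa [Set.iInter_const] at this
  rw [← measure_congr hB]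
  refine herg _ (MeasurableSet.iInter fun z => measurable_shiftConfig z hA) fun z => ?_
  ext η
  simp only [Set.mem_preimage, Set.mem_iInter, shiftConfig_shiftConfig]
  exact ⟨fun h w => by simpa using h (w - z), fun h w => h (w + z)⟩

/-- Preimages of measurable sets under a measurable version of `g` are a.e. invariant, hence of
measure 0 or 1; countably many such sets separate the points of ℝ. -/
theorem ae_const_of_ae_invariant [IsProbabilityMeasure μ] (hinv : TranslationInvariant μ)
    (herg : TranslationErgodic μ) {g : Config dim E → ℝ} (hg : AEMeasurable g μ)
    (hginv : ∀ z, g ∘ shiftConfig z =ᵐ[μ] g) : ∃ c, g =ᵐ[μ] fun _ => c := by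
  have hmk : ∀ z, hg.mk g ∘ shiftConfig z =ᵐ[μ] hg.mk g := fun z =>
    ((hinv.measurePreserving z).quasiMeasurePreserving.ae_eq_comp hg.ae_eq_mk.symm).trans
      ((hginv z).trans hg.ae_eq_mk)
  obtain ⟨c, hc⟩ := Filter.exists_eventuallyEq_const_of_forall_separating (l := ae μ)
    (f := hg.mk g) MeasurableSet fun S hS => by
      have hA : MeasurableSet (hg.mk g ⁻¹' S) := hg.measurable_mk hS
      rcases measure_eq_zero_or_one_of_ae_invariant herg hA (fun z => by
        filter_upwards [hmk z] with η hη
        exact congrArg (· ∈ S) hη) with h | h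
      · right
        exact measure_eq_zero_iff_ae_notMem.1 h
      · left
        exact (prob_compl_eq_zero_iff hA).2 h
  exact ⟨c, hg.ae_eq_mk.trans hc⟩

/-- The closed convex hull of the translates of `g` in L² contains a translation-invariant element,
which ergodicity makes constant. On a probability space, L²-closeness implies L¹-closeness. -/
theorem exists_convex_comb_shift_near_const_of_memLp [IsProbabilityMeasure μ]
    (hinv : TranslationInvariant μ) (herg : TranslationErgodic μ) {g : Config dim E → ℝ}
    (hg : MemLp g 2 μ) {ε : ℝ} (hε : 0 < ε) :
    ∃ (ι : Type) (t : Finset ι) (w : ι → ℝ) (y : ι → Site dim) (c : ℝ),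
      (∀ i ∈ t, 0 ≤ w i) ∧ ∑ i ∈ t, w i = 1 ∧
      ∫ η, |∑ i ∈ t, w i * g (shiftConfig (y i) η) - c| ∂μ < ε := by
  have hmp := hinv.measurePreserving
  obtain ⟨u, hu, hfix⟩ := exists_fixed_mem_closure_convexHull_orbit
    (fun z => Lp.compMeasurePreservingₗᵢ (E := ℝ) (p := 2) ℝ (shiftConfig z) (hmp z))
    (fun a b f => by
      refine (Lp.compMeasurePreserving_comp_apply f (hmp b) (hmp a)).symm.trans ?_
      have : shiftConfig b ∘ shiftConfig a = (shiftConfig (b + a) : Config dim E → _) :=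
        funext fun η => shiftConfig_shiftConfig b a η
      simp only [this]
      rfl) (hg.toLp g)
  obtain ⟨c, hc⟩ := ae_const_of_ae_invariant hinv herg (Lp.aestronglyMeasurable u).aemeasurable
    fun z => by
      have h1 := Lp.coeFn_compMeasurePreserving u (hmp z)
      have h2 : Lp.compMeasurePreserving (shiftConfig z) (hmp z) u = u := hfix z
      rw [h2] at h1
      exact h1.symm
  obtain ⟨h, hh, hdist⟩ := Metric.mem_closure_iff.1 hu ε hε
  rw [convexHull_eq] at hh
  obtain ⟨ι, t, w, v, hw, hw1, hv, rfl⟩ := hh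
  have hv' : ∀ i, ∃ y : Site dim, i ∈ t → v i =ᵐ[μ] fun η => g (shiftConfig y η) := by
    intro i
    by_cases hi : i ∈ t
    · obtain ⟨y, hy⟩ := hv i hi
      refine ⟨y, fun _ => ?_⟩
      rw [← hy]
      exact (Lp.coeFn_compMeasurePreserving _ (hmp y)).trans
        ((hmp y).quasiMeasurePreserving.ae_eq_comp hg.coeFn_toLp)
    · exact ⟨0, fun h => absurd h hi⟩
  choose y hy using hv'
  refine ⟨ι, t, w, y, c, hw, hw1, ?_⟩
  rw [Finset.centerMass_eq_of_sum_1 _ _ hw1] at hdist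
  set S : Lp ℝ 2 μ := ∑ i ∈ t, w i • v i with hS
  have hSae : S =ᵐ[μ] fun η => ∑ i ∈ t, w i * g (shiftConfig (y i) η) := by
    have h1 : ∀ᵐ η ∂μ, ∀ i ∈ t, (w i • v i : Lp ℝ 2 μ) η = w i * g (shiftConfig (y i) η) := by
      rw [Finset.eventually_all]
      intro i hi
      filter_upwards [Lp.coeFn_smul (w i) (v i), hy i hi] with η h1 h2
      rw [h1, Pi.smul_apply, h2, smul_eq_mul]
    filter_upwards [Lp.coeFn_finsetSum t fun i => w i • v i, h1] with η h2 h3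
    rw [hS, h2, Finset.sum_apply]
    exact Finset.sum_congr rfl h3
  have hae : (fun η => |∑ i ∈ t, w i * g (shiftConfig (y i) η) - c|)
      =ᵐ[μ] fun η => ‖(S - u : Lp ℝ 2 μ) η‖ := by
    filter_upwards [hSae, hc, Lp.coeFn_sub S u] with η h1 h2 h3
    rw [h3, Pi.sub_apply, h1, h2, Real.norm_eq_abs]
  rw [integral_congr_ae hae, integral_norm_eq_lintegral_enorm (Lp.aestronglyMeasurable _),
    ← eLpNorm_one_eq_lintegral_enorm]
  refine lt_of_le_of_lt ?_ (by rwa [dist_comm, dist_eq_norm] at hdist)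
  rw [Lp.norm_def]
  exact ENNReal.toReal_mono (Lp.eLpNorm_ne_top _)
    (eLpNorm_le_eLpNorm_of_exponent_le (by norm_num) (Lp.aestronglyMeasurable _))

/-- Mean ergodic theorem: some convex combination of translates of `f` is `L¹`-close to `∫ f`. -/
theorem exists_convex_comb_shift_near_integral [IsProbabilityMeasure μ]
    (hinv : TranslationInvariant μ) (herg : TranslationErgodic μ) {f : Config dim E → ℝ}
    (hf : Integrable f μ) {ε : ℝ} (hε : 0 < ε) :
    ∃ (ι : Type) (t : Finset ι) (w : ι → ℝ) (y : ι → Site dim),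
      (∀ i ∈ t, 0 ≤ w i) ∧ ∑ i ∈ t, w i = 1 ∧
      ∫ η, |∑ i ∈ t, w i * f (shiftConfig (y i) η) - ∫ η, f η ∂μ| ∂μ < ε := by
  have hmp := hinv.measurePreserving
  have hint : ∀ {h : Config dim E → ℝ}, Integrable h μ → ∀ z,
      Integrable (fun η => h (shiftConfig z η)) μ := fun hh z =>
    (hmp z).integrable_comp_of_integrable hh
  have hintegral : ∀ (h : Config dim E → ℝ) z, ∫ η, h (shiftConfig z η) ∂μ = ∫ η, h η ∂μ :=
    fun h z => (hmp z).integral_comp (measurableEmbedding_shiftConfig z) h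
  obtain ⟨g, hgf, -⟩ := (memLp_one_iff_integrable.2 hf).exists_simpleFunc_eLpNorm_sub_lt
    (by simp) (ε := ENNReal.ofReal (ε / 4)) (by simpa using hε)
  -- The L² result applies to the simple function `g`; translations preserve ‖f - g‖₁, so its
  -- weights also serve for `f`.
  have hg2 : MemLp g 2 μ := g.memLp_of_isFiniteMeasure 2 μ
  have hg1 : Integrable g μ := hg2.integrable (by norm_num)
  have hfg : ∫ η, |f η - g η| ∂μ < ε / 4 := by
    have h1 : ∫ η, |f η - g η| ∂μ = (eLpNorm (f - ⇑g) 1 μ).toReal := by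
      rw [eLpNorm_one_eq_lintegral_enorm,
        ← integral_norm_eq_lintegral_enorm (hf.sub hg1).aestronglyMeasurable]
      rfl
    rw [h1]
    exact ENNReal.toReal_lt_of_lt_ofReal hgf
  obtain ⟨ι, t, w, y, c, hw, hw1, hlt⟩ :=
    exists_convex_comb_shift_near_const_of_memLp hinv herg hg2 (ε := ε / 4) (by linarith)
  refine ⟨ι, t, w, y, hw, hw1, ?_⟩
  have hIf : Integrable (fun η => ∑ i ∈ t, w i * f (shiftConfig (y i) η)) μ :=
    integrable_finsetSum _ fun i _ => (hint hf _).const_mul _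
  have hIg : Integrable (fun η => ∑ i ∈ t, w i * g (shiftConfig (y i) η)) μ :=
    integrable_finsetSum _ fun i _ => (hint hg1 _).const_mul _
  have hIfc : Integrable (fun η => |∑ i ∈ t, w i * f (shiftConfig (y i) η) - c|) μ :=
    (hIf.sub (integrable_const c)).abs
  have hIgc : Integrable (fun η => |∑ i ∈ t, w i * g (shiftConfig (y i) η) - c|) μ :=
    (hIg.sub (integrable_const c)).abs
  have hId : ∀ i, Integrable (fun η => w i * |f (shiftConfig (y i) η) - g (shiftConfig (y i) η)|) μ :=
    fun i => ((hint hf (y i)).sub (hint hg1 (y i))).abs.const_mul _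
  have hnear : ∫ η, |∑ i ∈ t, w i * f (shiftConfig (y i) η) - c| ∂μ < ε / 2 := by
    calc ∫ η, |∑ i ∈ t, w i * f (shiftConfig (y i) η) - c| ∂μ
        ≤ ∫ η, (∑ i ∈ t, w i * |f (shiftConfig (y i) η) - g (shiftConfig (y i) η)|
            + |∑ i ∈ t, w i * g (shiftConfig (y i) η) - c|) ∂μ := by
          refine integral_mono hIfc
            ((integrable_finsetSum _ fun i _ => hId i).add hIgc)
            fun η => ?_
          have h1 : ∑ i ∈ t, w i * f (shiftConfig (y i) η) - c
              = ∑ i ∈ t, w i * (f (shiftConfig (y i) η) - g (shiftConfig (y i) η))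
                + (∑ i ∈ t, w i * g (shiftConfig (y i) η) - c) := by
            simp only [mul_sub, Finset.sum_sub_distrib]; ring
          simp only [h1]
          refine (abs_add_le _ _).trans (add_le_add_left ((Finset.abs_sum_le_sum_abs _ _).trans
            (Finset.sum_le_sum fun i hi => ?_)) _)
          rw [abs_mul, abs_of_nonneg (hw i hi)]
      _ = ∑ i ∈ t, w i * ∫ η, |f η - g η| ∂μ
            + ∫ η, |∑ i ∈ t, w i * g (shiftConfig (y i) η) - c| ∂μ := by
          rw [integral_add (integrable_finsetSum _ fun i _ => hId i)
            hIgc, integral_finsetSum _ fun i _ => hId i]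
          congr 1
          refine Finset.sum_congr rfl fun i _ => ?_
          rw [integral_const_mul, hintegral (fun η => |f η - g η|) (y i)]
      _ < ε / 2 := by
          rw [← Finset.sum_mul, hw1]; linarith
  have hmean : ∫ η, ∑ i ∈ t, w i * f (shiftConfig (y i) η) ∂μ = ∫ η, f η ∂μ := by
    rw [integral_finsetSum _ fun i _ => (hint hf _).const_mul _]
    simp only [integral_const_mul, hintegral f, ← Finset.sum_mul, hw1, one_mul]
  -- Convex combinations of translates keep the mean of `f`, so the constant `c` must be close to
  -- it.
  have hc : |c - ∫ η, f η ∂μ| < ε / 2 := by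
    refine lt_of_le_of_lt ?_ hnear
    have : ∫ η, f η ∂μ - c = ∫ η, (∑ i ∈ t, w i * f (shiftConfig (y i) η) - c) ∂μ := by
      rw [integral_sub hIf (integrable_const c), hmean]; simp
    rw [abs_sub_comm, this]
    exact abs_integral_le_integral_abs
  calc ∫ η, |∑ i ∈ t, w i * f (shiftConfig (y i) η) - ∫ η, f η ∂μ| ∂μ
      ≤ ∫ η, (|∑ i ∈ t, w i * f (shiftConfig (y i) η) - c| + |c - ∫ η, f η ∂μ|) ∂μ :=
        integral_mono (hIf.sub (integrable_const _)).abs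
          (hIfc.add (integrable_const _))
          fun η => abs_sub_le _ _ _
    _ < ε := by
        rw [integral_add hIfc (integrable_const _)]
        simp only [integral_const, probReal_univ, one_smul]
        linarith

end Shift

/-! ### Finite configurations and duality functions -/

namespace FactorizedDuality

section FinConfigs

variable {dim : ℕ} {Ehat : Set ℕ}

instance : Countable (FinConfig dim Ehat) :=
  inferInstanceAs (Countable {ξ : Site dim →₀ ℕ // ∀ x, ξ x ∈ Ehat})

instance : MeasurableSingletonClass (FinConfig dim Ehat) := ⟨fun _ => trivial⟩

namespace FinConfig

/-- The configuration without particles. -/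
def empty (h_zero : 0 ∈ Ehat) : FinConfig dim Ehat := ⟨0, fun _ => h_zero⟩

/-- The configuration with `k` particles at `x` and none elsewhere. -/
noncomputable def single (h_zero : 0 ∈ Ehat) (x : Site dim) {k : ℕ} (hk : k ∈ Ehat) :
    FinConfig dim Ehat :=
  ⟨Finsupp.single x k, fun y => by
    classical
    rw [Finsupp.single_apply]
    split_ifs
    exacts [hk, h_zero]⟩

/-- The configuration `ξ` with `k` particles put at the empty site `y`. -/
noncomputable def addSingle (ξ : FinConfig dim Ehat) (y : Site dim) {k : ℕ} (hk : k ∈ Ehat) (hy : ξ.1 y = 0) :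
    FinConfig dim Ehat :=
  ⟨ξ.1 + Finsupp.single y k, fun x => by
    classical
    by_cases hx : y = x
    · subst hx; simpa [hy] using hk
    · simpa [Finsupp.single_apply, hx] using ξ.2 x⟩

theorem size_empty (h_zero : 0 ∈ Ehat) : (empty h_zero : FinConfig dim Ehat).size = 0 := by
  simp [size, empty]

theorem size_single (h_zero : 0 ∈ Ehat) (x : Site dim) {k : ℕ} (hk : k ∈ Ehat) :
    (single h_zero x hk).size = k :=
  Finsupp.sum_single_index rfl

theorem size_addSingle (ξ : FinConfig dim Ehat) (y : Site dim) {k : ℕ} (hk : k ∈ Ehat)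
    (hy : ξ.1 y = 0) : (ξ.addSingle y hk hy).size = ξ.size + k := by
  simp only [size, addSingle]
  rw [Finsupp.sum_add_index' (fun _ => rfl) fun _ _ _ => rfl, Finsupp.sum_single_index rfl]

end FinConfig

end FinConfigs

section DualityFunction

variable {dim : ℕ} {E : Type*} {Ehat : Set ℕ} {d : ℕ → E → ℝ}

theorem dualityFun_empty (h_zero : 0 ∈ Ehat) (η : Config dim E) :
    dualityFun d (FinConfig.empty h_zero : FinConfig dim Ehat).1 η = 1 := by
  simp [dualityFun, FinConfig.empty]

theorem dualityFun_addSingle (hd_zero : ∀ e, d 0 e = 1) (ξ : FinConfig dim Ehat) (y : Site dim)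
    {k : ℕ} (hk : k ∈ Ehat) (hy : ξ.1 y = 0) (η : Config dim E) :
    dualityFun d (ξ.addSingle y hk hy).1 η = dualityFun d ξ.1 η * d k (η y) := by
  simp only [dualityFun, FinConfig.addSingle]
  rw [Finsupp.prod_add_index_of_disjoint, Finsupp.prod_single_index (h := fun x k => d k (η x))
    (hd_zero _)]
  refine Finset.disjoint_left.2 fun x hx hx' => ?_
  have : x = y := by simpa using Finsupp.support_single_subset hx'
  exact (Finsupp.mem_support_iff.1 hx) (this ▸ hy)

theorem dualityFun_single (hd_zero : ∀ e, d 0 e = 1) (y : Site dim) (k : ℕ) (η : Config dim E) :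
    dualityFun d (Finsupp.single y k) η = d k (η y) :=
  Finsupp.prod_single_index (hd_zero _)

variable [MeasurableSpace E]

theorem measurable_dualityFun (hd_meas : ∀ k ∈ Ehat, Measurable (d k)) (ξ : FinConfig dim Ehat) :
    Measurable fun η : Config dim E => dualityFun d ξ.1 η :=
  Finset.measurable_fun_prod _ fun x _ => (hd_meas _ (ξ.2 x)).comp (measurable_pi_apply x)

variable {μ : Measure (Config dim E)}

theorem UniformDomination.integrable_dualityFun (hUD : UniformDomination Ehat d μ)
    (hd_meas : ∀ k ∈ Ehat, Measurable (d k)) (ξ : FinConfig dim Ehat) :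
    Integrable (fun η => dualityFun d ξ.1 η) μ := by
  obtain ⟨f, hf, hle⟩ := hUD ξ.size
  exact hf.mono' (measurable_dualityFun hd_meas ξ).aestronglyMeasurable (hle ξ rfl)

end DualityFunction

/-! ### Harmonicity of the expected duality function -/

section Stationarity

variable {dim : ℕ} {E : Type*} [MeasurableSpace E] {Ehat : Set ℕ} {d : ℕ → E → ℝ}
  {X : MarkovProcess (FinConfig dim Ehat)} {Y : MarkovProcess (Config dim E)}
  {μ : Measure (Config dim E)}

theorem MarkovProcess.IsStationary.integral_expect {S : Type*} [MeasurableSpace S]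
    {Z : MarkovProcess S} {π : Measure S} (hstat : Z.IsStationary π) (t : ℝ≥0) {f : S → ℝ}
    (hf : Integrable f π) : ∫ x, Z.expect t x f ∂π = ∫ x, f x ∂π := by
  have h1 : (Z.trans t ∘ₖ Kernel.const Unit π) () = π := by
    rw [Kernel.comp_apply, Kernel.const_apply]; exact hstat t
  have h2 := Kernel.integral_comp (η := Z.trans t) (κ := Kernel.const Unit π) (a := ()) (f := f)
    (by rwa [h1])
  rw [h1] at h2
  exact h2.symm

/-- Stationarity: the expected duality function is harmonic along the dual process. -/
theorem expect_integral_dualityFun [IsProbabilityMeasure μ]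
    (hd_meas : ∀ k ∈ Ehat, Measurable (d k))
    (hdual : IsDual X Y d) (hcons : ConservesParticles X) (hUD : UniformDomination Ehat d μ)
    (hstat : Y.IsStationary μ) {t : ℝ≥0} (ht : 0 < t) (ξ : FinConfig dim Ehat) :
    X.expect t ξ (fun ξ' => ∫ η, dualityFun d ξ'.1 η ∂μ) = ∫ η, dualityFun d ξ.1 η ∂μ := by
  have := X.isMarkovKernel t
  obtain ⟨f, hf, hle⟩ := hUD ξ.size
  have hmeas : Measurable fun p : FinConfig dim Ehat × Config dim E => dualityFun d p.1.1 p.2 :=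
    measurable_from_prod_countable_right fun ξ' => measurable_dualityFun hd_meas ξ'
  -- Fubini is justified by one dominating function: almost surely ξ(t) has as many particles as ξ.
  have hint : Integrable (fun p : FinConfig dim Ehat × Config dim E => dualityFun d p.1.1 p.2)
      ((X.trans t ξ).prod μ) := by
    rw [integrable_prod_iff hmeas.aestronglyMeasurable]
    refine ⟨ae_of_all _ fun ξ' => hUD.integrable_dualityFun hd_meas ξ',
      (integrable_const (∫ η, f η ∂μ)).mono'
        hmeas.norm.stronglyMeasurable.integral_prod_right.aestronglyMeasurable ?_⟩
    filter_upwards [hcons t ξ] with ξ' hξ'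
    rw [Real.norm_of_nonneg (integral_nonneg fun _ => norm_nonneg _)]
    exact integral_mono_ae (hUD.integrable_dualityFun hd_meas ξ').norm hf (hle ξ' hξ')
  calc X.expect t ξ (fun ξ' => ∫ η, dualityFun d ξ'.1 η ∂μ)
      = ∫ η, X.expect t ξ (fun ξ' => dualityFun d ξ'.1 η) ∂μ := integral_integral_swap hint
    _ = ∫ η, Y.expect t η (fun η' => dualityFun d ξ.1 η') ∂μ := by
        simp only [hdual t ht ξ]
    _ = ∫ η, dualityFun d ξ.1 η ∂μ :=
        hstat.integral_expect t (hUD.integrable_dualityFun hd_meas ξ)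

/-- The bounds ∫ f_n may grow with n, so triviality is applied to the restriction to one level |ξ| =
n, extended by 0; conservation of particles keeps it harmonic. -/
theorem exists_integral_dualityFun_eq_of_size [IsProbabilityMeasure μ]
    (hd_meas : ∀ k ∈ Ehat, Measurable (d k))
    (hdual : IsDual X Y d) (hcons : ConservesParticles X) (hBHT : BoundedHarmonicTriviality X)
    (hUD : UniformDomination Ehat d μ) (hstat : Y.IsStationary μ) :
    ∃ ψ : ℕ → ℝ, ∀ ξ : FinConfig dim Ehat, ∫ η, dualityFun d ξ.1 η ∂μ = ψ ξ.size := by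
  have key : ∀ n : ℕ, ∃ c : ℝ, ∀ ξ : FinConfig dim Ehat, ξ.size = n →
      ∫ η, dualityFun d ξ.1 η ∂μ = c := by
    intro n
    obtain ⟨f, hf, hle⟩ := hUD n
    obtain ⟨ψ, -, hψ⟩ := hBHT (fun ξ => if ξ.size = n then ∫ η, dualityFun d ξ.1 η ∂μ else 0)
      ⟨|∫ η, f η ∂μ|, fun ξ => by
        split_ifs with h
        · refine le_trans ?_ (le_abs_self _)
          exact abs_integral_le_integral_abs.trans (integral_mono_ae
            (hUD.integrable_dualityFun hd_meas ξ).abs hf (hle ξ h))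
        · simp⟩
      fun t ht ξ => by
        beta_reduce
        split_ifs with h
        · rw [← expect_integral_dualityFun hd_meas hdual hcons hUD hstat ht ξ]
          refine integral_congr_ae ?_
          filter_upwards [hcons t ξ] with ξ' hξ'
          rw [if_pos (hξ'.trans h)]
        · refine integral_eq_zero_of_ae ?_
          filter_upwards [hcons t ξ] with ξ' hξ'
          rw [hξ', if_neg h]; rfl
    exact ⟨ψ n, fun ξ h => by simpa [h] using hψ ξ⟩
  choose ψ hψ using key
  exact ⟨ψ, fun ξ => hψ _ ξ rfl⟩

end Stationarity

/-! ### Multiplicativity in the number of particles -/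

section Ergodicity

variable {dim : ℕ} {E : Type*} [MeasurableSpace E] {Ehat : Set ℕ} {d : ℕ → E → ℝ}
  {μ : Measure (Config dim E)}

theorem infinite_site (hdim : 0 < dim) : Infinite (Site dim) := by
  have : Nonempty (Fin dim) := ⟨⟨0, hdim⟩⟩
  exact Pi.infinite_of_right

/-- As the lattice is infinite, the convex combinations of the mean ergodic theorem may be taken
over translations that avoid any given finite set. -/
theorem exists_convex_comb_shift_near_integral_avoiding [IsProbabilityMeasure μ] (hdim : 0 < dim)
    (hinv : TranslationInvariant μ) (herg : TranslationErgodic μ) {f : Config dim E → ℝ}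
    (hf : Integrable f μ) (F : Finset (Site dim)) {ε : ℝ} (hε : 0 < ε) :
    ∃ (ι : Type) (t : Finset ι) (w : ι → ℝ) (y : ι → Site dim),
      (∀ i ∈ t, 0 ≤ w i) ∧ ∑ i ∈ t, w i = 1 ∧ (∀ i ∈ t, y i ∉ F) ∧
      ∫ η, |∑ i ∈ t, w i * f (shiftConfig (y i) η) - ∫ η, f η ∂μ| ∂μ < ε := by
  classical
  obtain ⟨ι, t, w, y, hw, hw1, hlt⟩ := exists_convex_comb_shift_near_integral hinv herg hf hε
  have := infinite_site hdim
  -- A common extra translation by `z` moves every `y i` out of `F` and leaves the L¹ distance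
  -- unchanged.
  obtain ⟨z, hz⟩ := Infinite.exists_notMem_finset
    (Finset.image₂ (fun a i => a - y i) F t)
  refine ⟨ι, t, w, fun i => y i + z, hw, hw1, fun i hi h => hz ?_, ?_⟩
  · exact Finset.mem_image₂.2 ⟨_, h, i, hi, by simp⟩
  · rw [← (hinv.measurePreserving z).integral_comp (measurableEmbedding_shiftConfig z)] at hlt
    simpa only [shiftConfig_shiftConfig] using hlt

theorem integral_dualityFun_succ [IsProbabilityMeasure μ] (hdim : 0 < dim) (h_one : 1 ∈ Ehat)
    (h_zero : 0 ∈ Ehat)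
    (hd_meas : ∀ k ∈ Ehat, Measurable (d k)) (hd_zero : ∀ e, d 0 e = 1)
    (hUD : UniformDomination Ehat d μ)
    (hinv : TranslationInvariant μ) (herg : TranslationErgodic μ) {ψ : ℕ → ℝ}
    (hψ : ∀ ξ : FinConfig dim Ehat, ∫ η, dualityFun d ξ.1 η ∂μ = ψ ξ.size)
    (ξ : FinConfig dim Ehat) : ψ (ξ.size + 1) = ψ ξ.size * ψ 1 := by
  set g : Config dim E → ℝ := fun η => d 1 (η 0) with hg
  obtain ⟨δ, hδsize, hδ⟩ : ∃ δ : FinConfig dim Ehat, δ.size = 1 ∧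
      (fun η => dualityFun d δ.1 η) = g :=
    ⟨FinConfig.single h_zero 0 h_one, FinConfig.size_single h_zero 0 h_one,
      funext fun η => dualityFun_single hd_zero 0 1 η⟩
  have hgint : Integrable g μ := hδ ▸ hUD.integrable_dualityFun hd_meas δ
  have hgψ : ∫ η, g η ∂μ = ψ 1 := by
    rw [← hδ, hψ, hδsize]
  have hshift : ∀ y η, g (shiftConfig y η) = d 1 (η y) := fun y η => by
    simp [hg, shiftConfig]
  have hcomb := fun n : ℕ => exists_convex_comb_shift_near_integral_avoiding hdim hinv herg hgint
    ξ.1.support (Nat.one_div_pos_of_nat (α := ℝ) (n := n))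
  choose ι t w y hw hw1 hy hlt using hcomb
  simp only [hshift, hgψ] at hlt
  set A : ℕ → Config dim E → ℝ := fun n η => ∑ i ∈ t n, w n i * d 1 (η (y n i)) with hA
  have hAmeas : ∀ n, Measurable (A n) := fun n =>
    Finset.measurable_fun_sum _ fun i _ =>
      ((hd_meas 1 h_one).comp (measurable_pi_apply (y n i))).const_mul _
  have hlim : TendstoInMeasure μ A Filter.atTop fun _ => ψ 1 := by
    refine tendstoInMeasure_of_tendsto_eLpNorm one_ne_zero
      (fun n => (hAmeas n).aestronglyMeasurable) aestronglyMeasurable_const ?_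
    have hle : ∀ n : ℕ, eLpNorm (A n - fun _ => ψ 1) 1 μ ≤ ENNReal.ofReal (1 / ((n : ℝ) + 1)) := by
      intro n
      have hI : Integrable (A n - fun _ => ψ 1) μ := by
        refine Integrable.sub (integrable_finsetSum _ fun i _ => ?_) (integrable_const _)
        simp only [← hshift]
        exact ((hinv.measurePreserving _).integrable_comp_of_integrable hgint).const_mul _
      rw [eLpNorm_one_eq_lintegral_enorm, ← ofReal_integral_norm_eq_lintegral_enorm hI]
      exact ENNReal.ofReal_le_ofReal (hlt n).le
    refine tendsto_of_tendsto_of_tendsto_of_le_of_le tendsto_const_nhds ?_ (fun _ => zero_le) hle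
    simpa using ENNReal.tendsto_ofReal (tendsto_one_div_add_atTop_nhds_zero_nat (𝕜 := ℝ))
  -- L¹ convergence gives a.e. convergence only along a subsequence, which suffices since the
  -- integrals in `hconst` do not depend on `n`.
  obtain ⟨ns, -, hns⟩ := hlim.exists_seq_tendsto_ae
  obtain ⟨f, hf, hle⟩ := hUD (ξ.size + 1)
  have hempty : ∀ n, ∀ i ∈ t n, ξ.1 (y n i) = 0 := fun n i hi =>
    Finsupp.notMem_support_iff.1 (hy n i hi)
  have hbound : ∀ᵐ η ∂μ, ∀ ξ' : FinConfig dim Ehat, ξ'.size = ξ.size + 1 →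
      |dualityFun d ξ'.1 η| ≤ f η := by
    rw [ae_all_iff]
    intro ξ'
    by_cases h : ξ'.size = ξ.size + 1
    · filter_upwards [hle ξ' h] with η hη _ using hη
    · exact ae_of_all _ fun η h' => absurd h' h
  have hexp : ∀ n η, dualityFun d ξ.1 η * A n η
      = ∑ i ∈ (t n).attach, w n i *
        dualityFun d (ξ.addSingle (y n i) h_one (hempty n i i.2)).1 η := by
    intro n η
    rw [hA, Finset.mul_sum, ← Finset.sum_attach]
    refine Finset.sum_congr rfl fun i _ => ?_
    rw [dualityFun_addSingle hd_zero]; ring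
  have hconst : ∀ n, ∫ η, dualityFun d ξ.1 η * A n η ∂μ = ψ (ξ.size + 1) := by
    intro n
    simp only [hexp]
    rw [integral_finsetSum _ fun i _ => (hUD.integrable_dualityFun hd_meas _).const_mul _]
    simp only [integral_const_mul, hψ, FinConfig.size_addSingle]
    rw [← Finset.sum_mul, Finset.sum_attach (t n) (w n), hw1, one_mul]
  have hDCT := tendsto_integral_of_dominated_convergence
    (F := fun n η => dualityFun d ξ.1 η * A (ns n) η) (f := fun η => dualityFun d ξ.1 η * ψ 1)
    f (fun n => ((measurable_dualityFun hd_meas ξ).mul (hAmeas (ns n))).aestronglyMeasurable) hf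
    (fun n => by
      filter_upwards [hbound] with η hη
      rw [hexp, Real.norm_eq_abs]
      calc |∑ i ∈ (t (ns n)).attach, w (ns n) i *
              dualityFun d (ξ.addSingle (y (ns n) i) h_one (hempty (ns n) i i.2)).1 η|
          ≤ ∑ i ∈ (t (ns n)).attach, w (ns n) i * f η := by
            refine (Finset.abs_sum_le_sum_abs _ _).trans (Finset.sum_le_sum fun i _ => ?_)
            rw [abs_mul, abs_of_nonneg (hw _ _ i.2)]
            exact mul_le_mul_of_nonneg_left (hη _ (FinConfig.size_addSingle _ _ _ _))
              (hw _ _ i.2)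
        _ = f η := by
            rw [← Finset.sum_mul, Finset.sum_attach (t (ns n)) (w (ns n)), hw1, one_mul])
    (by filter_upwards [hns] with η hη using hη.const_mul _)
  simp only [hconst] at hDCT
  rw [tendsto_nhds_unique tendsto_const_nhds hDCT, integral_mul_const, hψ]

/-- `Ehat` need not contain `n`, so the particles are put singly on distinct sites. -/
theorem exists_finConfig_size (hdim : 0 < dim) (h_zero : 0 ∈ Ehat) (h_one : 1 ∈ Ehat) (n : ℕ) :
    ∃ ξ : FinConfig dim Ehat, ξ.size = n := by
  induction n with
  | zero => exact ⟨_, FinConfig.size_empty h_zero⟩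
  | succ n ih =>
    obtain ⟨ξ, rfl⟩ := ih
    have := infinite_site hdim
    obtain ⟨y, hy⟩ := Infinite.exists_notMem_finset ξ.1.support
    exact ⟨ξ.addSingle y h_one (Finsupp.notMem_support_iff.1 hy), FinConfig.size_addSingle _ _ _ _⟩

theorem integral_dualityFun_eq_pow [IsProbabilityMeasure μ] (hdim : 0 < dim) (h_zero : 0 ∈ Ehat)
    (h_one : 1 ∈ Ehat)
    (hd_meas : ∀ k ∈ Ehat, Measurable (d k)) (hd_zero : ∀ e, d 0 e = 1)
    (hUD : UniformDomination Ehat d μ)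
    (hinv : TranslationInvariant μ) (herg : TranslationErgodic μ) {ψ : ℕ → ℝ}
    (hψ : ∀ ξ : FinConfig dim Ehat, ∫ η, dualityFun d ξ.1 η ∂μ = ψ ξ.size)
    (ξ : FinConfig dim Ehat) : ∫ η, dualityFun d ξ.1 η ∂μ = ψ 1 ^ ξ.size := by
  have hpow : ∀ n, ψ n = ψ 1 ^ n := by
    intro n
    induction n with
    | zero =>
      have := hψ (FinConfig.empty h_zero)
      rw [FinConfig.size_empty] at this
      simpa [dualityFun_empty] using this.symm
    | succ n ih =>
      obtain ⟨ξ, rfl⟩ := exists_finConfig_size hdim h_zero h_one n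
      rw [integral_dualityFun_succ hdim h_one h_zero hd_meas hd_zero hUD hinv herg hψ ξ, ih,
        pow_succ]
  rw [hψ, hpow]

end Ergodicity

end FactorizedDuality

/-! ### Determinacy with signed weights -/

namespace FactorizedDuality

section Determining

variable {E : Type*} [MeasurableSpace E] {Ehat : Set ℕ} {d : ℕ → E → ℝ}

/-- Measure determining functions with `d 0 = 1` determine finite measures, too. -/
theorem MeasureDetermining.eq_of_isFiniteMeasure (hdet : MeasureDetermining Ehat d)
    (h_zero : 0 ∈ Ehat) (hd_zero : ∀ e, d 0 e = 1) (m₁ m₂ : Measure E) [IsFiniteMeasure m₁]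
    [IsFiniteMeasure m₂]
    (h : ∀ k ∈ Ehat, Integrable (d k) m₁ ∧ Integrable (d k) m₂ ∧
      ∫ e, d k e ∂m₁ = ∫ e, d k e ∂m₂) : m₁ = m₂ := by
  have hmass : m₁ Set.univ = m₂ Set.univ := by
    have := (h 0 h_zero).2.2
    simp only [hd_zero, integral_const, smul_eq_mul, mul_one] at this
    exact (measureReal_eq_measureReal_iff).1 this
  by_cases h0 : m₁ Set.univ = 0
  · rw [Measure.measure_univ_eq_zero.1 h0, Measure.measure_univ_eq_zero.1 (hmass.symm.trans h0)]
  set a := m₁ Set.univ with ha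
  have hatop : a ≠ ∞ := measure_ne_top _ _
  have heq : a⁻¹ • m₁ = a⁻¹ • m₂ := by
    refine hdet _ _ ⟨?_⟩ ⟨?_⟩ fun k hk => ⟨?_, ?_, ?_⟩
    · rw [Measure.smul_apply, ← ha, smul_eq_mul, ENNReal.inv_mul_cancel h0 hatop]
    · rw [Measure.smul_apply, ← hmass, smul_eq_mul, ENNReal.inv_mul_cancel h0 hatop]
    · exact (h k hk).1.smul_measure (ENNReal.inv_ne_top.2 h0)
    · exact (h k hk).2.1.smul_measure (ENNReal.inv_ne_top.2 h0)
    · rw [integral_smul_measure, integral_smul_measure, (h k hk).2.2]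
  have := congrArg (a • ·) heq
  simpa only [smul_smul, ENNReal.mul_inv_cancel h0 hatop, one_smul] using this

variable {Ω : Type*} [MeasurableSpace Ω] {μ : Measure Ω}

/-- The law of `X` weighted by the positive part of `Ψ`, plus a multiple of `ν`. -/
noncomputable def weightedLaw (μ : Measure Ω) (Ψ : Ω → ℝ) (X : Ω → E) (c : ℝ) (ν : Measure E) : Measure E :=
  (μ.withDensity fun ω => ((Ψ ω).toNNReal : ℝ≥0∞)).map X + c.toNNReal • ν

theorem isFiniteMeasure_weightedLaw {Ψ : Ω → ℝ} (hΨ : Integrable Ψ μ) (X : Ω → E) (c : ℝ)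
    (ν : Measure E) [IsFiniteMeasure ν] : IsFiniteMeasure (weightedLaw μ Ψ X c ν) := by
  have := isFiniteMeasure_withDensity_ofReal hΨ.2
  have : IsFiniteMeasure (μ.withDensity fun ω => ((Ψ ω).toNNReal : ℝ≥0∞)) := this
  unfold weightedLaw
  infer_instance

theorem integral_weightedLaw {Ψ : Ω → ℝ} (hΨ : Integrable Ψ μ) {X : Ω → E} (hX : Measurable X)
    (c : ℝ) {ν : Measure E} {h : E → ℝ} (hm : Measurable h) (hν : Integrable h ν)
    (hint : Integrable (fun ω => Ψ ω * h (X ω)) μ) :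
    Integrable h (weightedLaw μ Ψ X c ν) ∧ Integrable (fun ω => max (Ψ ω) 0 * h (X ω)) μ ∧
    ∫ e, h e ∂(weightedLaw μ Ψ X c ν)
      = ∫ ω, max (Ψ ω) 0 * h (X ω) ∂μ + max c 0 * ∫ e, h e ∂ν := by
  have hΨm : AEMeasurable (fun ω => (Ψ ω).toNNReal) μ := hΨ.aemeasurable.real_toNNReal
  have hpos : Integrable (fun ω => max (Ψ ω) 0 * h (X ω)) μ := by
    refine hint.mono ((hΨ.pos_part.aestronglyMeasurable).mul
      (hm.comp hX).aestronglyMeasurable) (ae_of_all _ fun ω => ?_)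
    rw [norm_mul, norm_mul]
    refine mul_le_mul_of_nonneg_right ?_ (norm_nonneg _)
    rw [Real.norm_of_nonneg (le_max_right _ _), Real.norm_eq_abs]
    exact max_le (le_abs_self _) (abs_nonneg _)
  have hI : Integrable (fun ω => h (X ω))
      (μ.withDensity fun ω => ((Ψ ω).toNNReal : ℝ≥0∞)) := by
    rw [integrable_withDensity_iff_integrable_smul₀ hΨm]
    exact hpos
  have h1 : Integrable h ((μ.withDensity fun ω => ((Ψ ω).toNNReal : ℝ≥0∞)).map X) :=
    (integrable_map_measure hm.aestronglyMeasurable hX.aemeasurable).2 hI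
  have h2 : Integrable h (c.toNNReal • ν) := hν.smul_measure_nnreal
  refine ⟨h1.add_measure h2, hpos, ?_⟩
  unfold weightedLaw
  rw [integral_add_measure h1 h2, integral_map hX.aemeasurable hm.aestronglyMeasurable,
    integral_withDensity_eq_integral_smul₀ hΨm, integral_smul_nnreal_measure]
  rfl

/-- If the weighted moments of `X` are those of `ν`, so is the weighted law, for signed weights. -/
theorem MeasureDetermining.integral_mul_indicator (hdet : MeasureDetermining Ehat d)
    (h_zero : 0 ∈ Ehat) (hd_meas : ∀ k ∈ Ehat, Measurable (d k)) (hd_zero : ∀ e, d 0 e = 1)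
    {Ψ : Ω → ℝ} (hΨ : Integrable Ψ μ) {X : Ω → E} (hX : Measurable X)
    {ν : Measure E} [IsProbabilityMeasure ν] (hν : ∀ k ∈ Ehat, Integrable (d k) ν)
    (hint : ∀ k ∈ Ehat, Integrable (fun ω => Ψ ω * d k (X ω)) μ)
    (heq : ∀ k ∈ Ehat, ∫ ω, Ψ ω * d k (X ω) ∂μ = (∫ ω, Ψ ω ∂μ) * ∫ e, d k e ∂ν)
    {B : Set E} (hB : MeasurableSet B) :
    ∫ ω, Ψ ω * B.indicator 1 (X ω) ∂μ = (∫ ω, Ψ ω ∂μ) * ν.real B := by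
  set c := ∫ ω, Ψ ω ∂μ with hc
  -- The signed identity "law of `X` weighted by `Ψ` equals c ν" is rearranged into positive
  -- measures: Ψ⁺-law + c⁻ν on one side, Ψ⁻-law + c⁺ν on the other.
  set m₁ := weightedLaw μ Ψ X (-c) ν with hm₁
  set m₂ := weightedLaw μ (-Ψ) X c ν with hm₂
  have : IsFiniteMeasure m₁ := isFiniteMeasure_weightedLaw hΨ X (-c) ν
  have : IsFiniteMeasure m₂ := isFiniteMeasure_weightedLaw hΨ.neg X c ν
  have hmax : ∀ a : ℝ, max a 0 - max (-a) 0 = a := fun a => by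
    rcases le_total 0 a with h | h
    · rw [max_eq_left h, max_eq_right (by linarith)]; ring
    · rw [max_eq_right h, max_eq_left (by linarith)]; ring
  have hdiff : ∀ h : E → ℝ, Measurable h → Integrable h ν →
      Integrable (fun ω => Ψ ω * h (X ω)) μ →
      Integrable h m₁ ∧ Integrable h m₂ ∧
      ∫ e, h e ∂m₁ - ∫ e, h e ∂m₂ = ∫ ω, Ψ ω * h (X ω) ∂μ - c * ∫ e, h e ∂ν := by
    intro h hm hhν hhint
    obtain ⟨i1, p1, e1⟩ := integral_weightedLaw hΨ hX (-c) hm hhν hhint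
    obtain ⟨i2, p2, e2⟩ := integral_weightedLaw hΨ.neg hX c hm hhν
      (by simp only [Pi.neg_apply, neg_mul]; exact hhint.neg)
    refine ⟨i1, i2, ?_⟩
    have h3 : ∫ ω, Ψ ω * h (X ω) ∂μ = ∫ ω, max (Ψ ω) 0 * h (X ω) ∂μ
        - ∫ ω, max ((-Ψ) ω) 0 * h (X ω) ∂μ := by
      rw [← integral_sub p1 p2]
      refine integral_congr_ae (ae_of_all _ fun ω => ?_)
      simp only [Pi.neg_apply, ← sub_mul, hmax]
    rw [e1, e2, h3]
    linear_combination (-∫ e, h e ∂ν) * hmax c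
  have hm : m₁ = m₂ := hdet.eq_of_isFiniteMeasure h_zero hd_zero m₁ m₂ fun k hk => by
    obtain ⟨i1, i2, e⟩ := hdiff (d k) (hd_meas k hk) (hν k hk) (hint k hk)
    exact ⟨i1, i2, by rw [heq k hk, sub_self, sub_eq_zero] at e; exact e⟩
  have hBm : Measurable (B.indicator (1 : E → ℝ)) := measurable_one.indicator hB
  have hBle : ∀ e, ‖B.indicator (1 : E → ℝ) e‖ ≤ 1 := fun e =>
    (norm_indicator_le_norm_self _ _).trans (by simp)
  obtain ⟨-, -, e⟩ := hdiff (B.indicator 1) hBm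
    ((integrable_const (1 : ℝ)).mono' hBm.aestronglyMeasurable (ae_of_all _ hBle))
    (hΨ.mul_bdd (c := 1) (hBm.comp hX).aestronglyMeasurable (ae_of_all _ fun ω => hBle _))
  rw [hm, sub_self, integral_indicator_one hB] at e
  linarith

end Determining

/-! ### Product structure -/

section Product

variable {dim : ℕ} {E : Type*} [MeasurableSpace E] {Ehat : Set ℕ} {d : ℕ → E → ℝ}
  {μ : Measure (Config dim E)}

theorem prod_indicator_eq_indicator_pi {ι α : Type*} (S : Finset ι) (A : ι → Set α) (η : ι → α) :
    ∏ x ∈ S, (A x).indicator (1 : α → ℝ) (η x) = ((S : Set ι).pi A).indicator 1 η := by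
  classical
  by_cases h : η ∈ (S : Set ι).pi A
  · rw [Set.indicator_of_mem h]
    exact Finset.prod_eq_one fun x hx => Set.indicator_of_mem (h x hx) _
  · rw [Set.indicator_of_notMem h]
    simp only [Set.mem_pi, not_forall] at h
    obtain ⟨x, hx, hxA⟩ := h
    exact Finset.prod_eq_zero hx (Set.indicator_of_notMem hxA _)

/-- Induction on `S`: the weight is the product of the earlier indicators times D(ξ, ·), of either
sign. Keeping ξ arbitrary off `S` lets the induction hypothesis also cover ξ with k particles added
at the new site, which supplies the moments needed for determinacy. -/
theorem integral_prod_indicator_mul_dualityFun [IsProbabilityMeasure μ]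
    (hdet : MeasureDetermining Ehat d) (h_zero : 0 ∈ Ehat)
    (hd_meas : ∀ k ∈ Ehat, Measurable (d k)) (hd_zero : ∀ e, d 0 e = 1)
    (hint : ∀ ξ : FinConfig dim Ehat, Integrable (fun η => dualityFun d ξ.1 η) μ)
    {ρ : ℝ} (hρ : ∀ ξ : FinConfig dim Ehat, ∫ η, dualityFun d ξ.1 η ∂μ = ρ ^ ξ.size)
    {ν : Measure E} [IsProbabilityMeasure ν]
    (hν : ∀ k ∈ Ehat, Integrable (d k) ν ∧ ∫ e, d k e ∂ν = ρ ^ k)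
    {A : Site dim → Set E} (hA : ∀ x, MeasurableSet (A x)) (S : Finset (Site dim)) :
    ∀ ξ : FinConfig dim Ehat, (∀ x ∈ S, ξ.1 x = 0) →
      ∫ η, (∏ x ∈ S, (A x).indicator 1 (η x)) * dualityFun d ξ.1 η ∂μ
        = (∏ x ∈ S, ν.real (A x)) * ρ ^ ξ.size := by
  classical
  have hI : ∀ (S : Finset (Site dim)) (ξ : FinConfig dim Ehat),
      Integrable (fun η => (∏ x ∈ S, (A x).indicator 1 (η x)) * dualityFun d ξ.1 η) μ := by
    intro S ξ
    refine (hint ξ).bdd_mul (c := 1) (Finset.measurable_fun_prod _ fun x _ =>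
      (measurable_one.indicator (hA x)).comp (measurable_pi_apply x)).aestronglyMeasurable
      (ae_of_all _ fun η => ?_)
    rw [prod_indicator_eq_indicator_pi]
    exact (norm_indicator_le_norm_self _ _).trans (by simp)
  induction S using Finset.induction_on with
  | empty => intro ξ _; simpa using hρ ξ
  | insert y S hy ih =>
    intro ξ hξ
    have hξS : ∀ x ∈ S, ξ.1 x = 0 := fun x hx => hξ x (Finset.mem_insert_of_mem hx)
    have hξy : ξ.1 y = 0 := hξ y (Finset.mem_insert_self _ _)
    have hadd : ∀ k (hk : k ∈ Ehat),
        (fun η => (∏ x ∈ S, (A x).indicator (1 : E → ℝ) (η x)) * dualityFun d ξ.1 η * d k (η y))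
        = fun η => (∏ x ∈ S, (A x).indicator 1 (η x)) *
          dualityFun d (ξ.addSingle y hk hξy).1 η := fun k hk => funext fun η => by
      rw [dualityFun_addSingle hd_zero, mul_assoc]
    have key := hdet.integral_mul_indicator h_zero hd_meas hd_zero (hI S ξ)
      (measurable_pi_apply y) (fun k hk => (hν k hk).1)
      (fun k hk => by rw [hadd k hk]; exact hI S _)
      (fun k hk => by
        rw [hadd k hk, ih _ fun x hx => ?_, ih ξ hξS, (hν k hk).2, FinConfig.size_addSingle,
          pow_add, mul_assoc]
        have : x ≠ y := fun h => hy (h ▸ hx)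
        simp [FinConfig.addSingle, hξS x hx, this])
      (hA y)
    rw [ih ξ hξS] at key
    simp only [Finset.prod_insert hy]
    calc ∫ η, (A y).indicator 1 (η y) * (∏ x ∈ S, (A x).indicator 1 (η x)) * dualityFun d ξ.1 η ∂μ
        = ∫ η, (∏ x ∈ S, (A x).indicator 1 (η x)) * dualityFun d ξ.1 η
            * (A y).indicator 1 (η y) ∂μ := by
          refine integral_congr_ae (ae_of_all _ fun η => ?_)
          simp only
          ring
      _ = _ := by rw [key]; ring

/-- If the duality functions have the same integrals as under a product measure and their
single-site factors are measure determining, then `μ` is a product measure. -/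
theorem eq_infinitePi_of_integral_dualityFun [IsProbabilityMeasure μ]
    (hdet : MeasureDetermining Ehat d) (h_zero : 0 ∈ Ehat)
    (hd_meas : ∀ k ∈ Ehat, Measurable (d k)) (hd_zero : ∀ e, d 0 e = 1)
    (hint : ∀ ξ : FinConfig dim Ehat, Integrable (fun η => dualityFun d ξ.1 η) μ)
    {ρ : ℝ} (hρ : ∀ ξ : FinConfig dim Ehat, ∫ η, dualityFun d ξ.1 η ∂μ = ρ ^ ξ.size)
    {ν : Measure E} [IsProbabilityMeasure ν]
    (hν : ∀ k ∈ Ehat, Integrable (d k) ν ∧ ∫ e, d k e ∂ν = ρ ^ k) :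
    μ = Measure.infinitePi fun _ => ν := by
  refine Measure.eq_infinitePi _ fun S A hA => ?_
  -- For the empty ξ only the indicators remain, giving the probabilities of cylinder sets.
  have h1 := integral_prod_indicator_mul_dualityFun hdet h_zero hd_meas hd_zero hint hρ hν hA S
    (FinConfig.empty h_zero) fun _ _ => rfl
  simp only [dualityFun_empty, FinConfig.size_empty, pow_zero, mul_one,
    prod_indicator_eq_indicator_pi] at h1
  rw [integral_indicator_one (MeasurableSet.pi S.countable_toSet fun x _ => hA x)] at h1
  rw [← ENNReal.toReal_eq_toReal_iff' (measure_ne_top _ _)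
    (ENNReal.prod_ne_top fun x _ => measure_ne_top _ _), ENNReal.toReal_prod]
  exact h1

end Product

end FactorizedDuality

theorem theorem3p3 {dim : ℕ} (hdim : 0 < dim) {E : Type*} [MeasurableSpace E]
    (Ehat : Set ℕ) (h_zero : 0 ∈ Ehat) (h_one : 1 ∈ Ehat)
    (X : MarkovProcess (FinConfig dim Ehat)) (Y : MarkovProcess (Config dim E))
    (d : ℕ → E → ℝ) (hd_meas : ∀ k ∈ Ehat, Measurable (d k)) (hd_zero : ∀ e, d 0 e = 1)
    (hdual : IsDual X Y d) (hcons : ConservesParticles X)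
    (hBHT : BoundedHarmonicTriviality X)
    (μ : Measure (Config dim E)) [IsProbabilityMeasure μ]
    (hUD : UniformDomination Ehat d μ)
    (hinv : TranslationInvariant μ) (herg : TranslationErgodic μ) (hstat : Y.IsStationary μ) :
    (∀ (ξ : FinConfig dim Ehat) (x : Site dim),
      ∫ η, dualityFun d ξ.1 η ∂μ
        = (∫ η, dualityFun d (Finsupp.single x 1) η ∂μ) ^ ξ.size) ∧
    (MeasureDetermining Ehat d →
      ∃ (ν : Measure E) (_ : IsProbabilityMeasure ν), μ = Measure.infinitePi (fun _ => ν)) := by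

  obtain ⟨ψ, hψ⟩ := exists_integral_dualityFun_eq_of_size hd_meas hdual hcons hBHT hUD hstat
  have hpow := integral_dualityFun_eq_pow hdim h_zero h_one hd_meas hd_zero hUD hinv herg hψ
  have hsingle : ∀ (x : Site dim) {k : ℕ} (hk : k ∈ Ehat),
      (fun η : Config dim E => dualityFun d (FinConfig.single h_zero x hk).1 η)
      = fun η => d k (η x) := fun x k hk => funext fun η => dualityFun_single hd_zero x k η
  have hmoment : ∀ (x : Site dim) {k : ℕ}, k ∈ Ehat → ∫ η, d k (η x) ∂μ = ψ 1 ^ k := by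
    intro x k hk
    rw [← hsingle x hk, hpow, FinConfig.size_single]
  refine ⟨fun ξ x => ?_, fun hdet => ?_⟩
  · simp only [dualityFun_single hd_zero]
    rw [hpow, hmoment x h_one, pow_one]
  · have h0 : Measurable fun η : Config dim E => η 0 := measurable_pi_apply 0
    have hν : IsProbabilityMeasure (μ.map fun η => η 0) :=
      Measure.isProbabilityMeasure_map h0.aemeasurable
    refine ⟨μ.map fun η => η 0, hν, eq_infinitePi_of_integral_dualityFun hdet h_zero hd_meas
      hd_zero (hUD.integrable_dualityFun hd_meas) hpow fun k hk => ⟨?_, ?_⟩⟩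
    · refine (integrable_map_measure (hd_meas k hk).aestronglyMeasurable h0.aemeasurable).2 ?_
      have := hUD.integrable_dualityFun hd_meas
        (FinConfig.single h_zero 0 hk)
      rw [hsingle 0 hk] at this
      exact this
    · rw [integral_map h0.aemeasurable (hd_meas k hk).aestronglyMeasurable]
      exact hmoment 0 hk
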